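/- Let $n\ge 1$ and let $w$ be a weight on $\mathbb{R}^n$, i.e. a locally integrable function with $w>0$ almost everywhere. Cubes $Q\subset\mathbb{R}^n$ are nondegenerate with sides parallel to the coordinate axes, and $|Q|$ is the Lebesgue measure of $Q$. For a cube $Q$ and $t>0$ put $$K(t,w\chi_Q;L^1(Q),L^\infty(Q))=\inf\{\|g\|_{L^1(Q)}+t\|h\|_{L^\infty(Q)} : w\chi_Q=g+h,\ g\in L^1(Q),\ h\in L^\infty(Q)\},$$ and let $(w\chi_Q)^*(t)=\inf\{a\ge 0: |\{x: |w\chi_Q(x)|>a\}|\le t\}$ be the decreasing rearrangement. A non-negative function $\phi$ on $(0,l)$ is almost increasing with constant $C\ge1$ if $\phi(s)\le C\phi(t)$ whenever $0<s\le t<l$. Let $\mathrm{ind}\{K(\cdot,w\chi_Q;L^1(Q),L^\infty(Q))\}_Q$ be the supremum of all $\delta\ge0$ for which there are $\gamma\in(0,1)$ and $C\ge1$ such that for every cube $Q$ the function $s\mapsto K(s,w\chi_Q;L^1(Q),L^\infty(Q))\,s^{-\delta}$ is almost increasing on $(0,\gamma|Q|)$ with constant $C$. Let $\widetilde{\mathrm{ind}}(w)$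 (the index of Anderson--Carro--Kwon--Soria type) be the infimum, with $\inf\emptyset=\infty$, of all $\lambda>0$ for which there are $r\in(0,1)$ and $\widetilde\gamma>0$ such that $$\frac{(w\chi_Q)^*(s)}{(w\chi_Q)^*(t)}\le\widetilde\gamma\left(\frac st\right)^{-\lambda}\qquad\text{for all cubes }Q\text{ and all }0<s\le t<r|Q|$$ (equivalently, the functions $t^{\lambda}(w\chi_Q)^*(t)$ are almost increasing on $(0,r|Q|)$, with a constant independent of $Q$). Then $$\mathrm{ind}\{K(\cdot,w\chi_Q;L^1(Q),L^\infty(Q))\}_Q>0\iff\widetilde{\mathrm{ind}}(w)<1.$$ -/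

import Mathlib

open MeasureTheory Set
open scoped ENNReal NNReal

namespace WeightIndex

/-- A weight on `ℝⁿ`: a locally integrable function that is positive (almost everywhere). -/
structure IsWeight {n : ℕ} (w : (Fin n → ℝ) → ℝ) : Prop where
  locallyIntegrable : LocallyIntegrable w volume
  pos : ∀ᵐ x ∂(volume : Measure (Fin n → ℝ)), 0 < w x

/-- A (nondegenerate) cube in `ℝⁿ` with sides parallel to the coordinate axes. -/
def IsCube {n : ℕ} (Q : Set (Fin n → ℝ)) : Prop :=
  ∃ (a : Fin n → ℝ) (l : ℝ), 0 < l ∧ Q = {x | ∀ i, a i ≤ x i ∧ x i ≤ a i + l}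

/-- The K-functional `K(t, f; L^{p₀}(μ), L^{p₁}(μ))`: the infimum of
`‖g‖_{p₀} + t ‖h‖_{p₁}` over all decompositions `f = g + h` (almost everywhere) with
`g ∈ L^{p₀}(μ)` and `h ∈ L^{p₁}(μ)`. -/
noncomputable def kFunctional {α : Type*} [MeasurableSpace α] (μ : Measure α)
    (p₀ p₁ : ℝ≥0∞) (f : α → ℝ) (t : ℝ) : ℝ≥0∞ :=
  ⨅ (g : α → ℝ) (h : α → ℝ) (_ : MemLp g p₀ μ) (_ : MemLp h p₁ μ) (_ : f =ᵐ[μ] g + h),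
    eLpNorm g p₀ μ + ENNReal.ofReal t * eLpNorm h p₁ μ

/-- The decreasing rearrangement `f^*(t) = inf {a ≥ 0 : μ {|f| > a} ≤ t}`. -/
noncomputable def rearrangement {α : Type*} [MeasurableSpace α] (μ : Measure α)
    (f : α → ℝ) (t : ℝ) : ℝ≥0∞ :=
  sInf {a : ℝ≥0∞ | μ {x | a < ‖f x‖ₑ} ≤ ENNReal.ofReal t}

/-- The non-negative function `φ` is almost increasing on `(0, l)` with constant `C`. -/
def AlmostIncreasing (C : ℝ≥0) (l : ℝ) (φ : ℝ → ℝ≥0∞) : Prop :=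
  1 ≤ C ∧ ∀ s ∈ Ioo 0 l, ∀ t ∈ Ioo 0 l, s ≤ t → φ s ≤ C * φ t

/-- The index `ind {φ_Q}_Q` of a family of non-negative functions indexed by cubes: the supremum
of all `δ ≥ 0` such that, for some `γ ∈ (0,1)`, the functions `φ_Q(s) s^{-δ}` are almost increasing
on `(0, γ |Q|)` for all cubes `Q`, with a constant that does not depend on `Q`. -/
noncomputable def familyIndex {n : ℕ} (φ : Set (Fin n → ℝ) → ℝ → ℝ≥0∞) : ℝ≥0∞ :=
  ⨆ (δ : ℝ≥0) (_ : ∃ γ ∈ Ioo (0 : ℝ) 1, ∃ C : ℝ≥0, ∀ Q : Set (Fin n → ℝ), IsCube Q →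
      AlmostIncreasing C (γ * volume.real Q)
        (fun s => φ Q s * ENNReal.ofReal (s ^ (-(δ : ℝ))))),
    (δ : ℝ≥0∞)

/-- The family `Q ↦ K(·, w χ_Q; L¹(Q), L^∞(Q))` attached to `w`. -/
noncomputable def kFamily {n : ℕ} (w : (Fin n → ℝ) → ℝ) (Q : Set (Fin n → ℝ)) :
    ℝ → ℝ≥0∞ :=
  kFunctional (volume.restrict Q) 1 ∞ (Q.indicator w)

/-- The growth condition of exponent `a > 0`: there are `r ∈ (0,1)` and `c > 0` with
`(w χ_Q)^*(s) / (w χ_Q)^*(t) ≤ c (s / t)^{-a}` for all cubes `Q` and `0 < s ≤ t < r |Q|`. -/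
def RearrangementGrowth {n : ℕ} (w : (Fin n → ℝ) → ℝ) (a : ℝ≥0) : Prop :=
  0 < a ∧ ∃ r ∈ Ioo (0 : ℝ) 1, ∃ c : ℝ≥0, 0 < c ∧
    ∀ Q : Set (Fin n → ℝ), IsCube Q → ∀ s t : ℝ, 0 < s → s ≤ t → t < r * volume.real Q →
      rearrangement volume (Q.indicator w) s / rearrangement volume (Q.indicator w) t
        ≤ c * ENNReal.ofReal ((s / t) ^ (-(a : ℝ)))

/-- The Anderson–Carro–Kwon–Soria type index: the infimum of the admissible exponents
(`∞` if there is none). -/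
noncomputable def rearrangementIndex {n : ℕ} (w : (Fin n → ℝ) → ℝ) : ℝ≥0∞ :=
  ⨅ (a : ℝ≥0) (_ : RearrangementGrowth w a), (a : ℝ≥0∞)

end WeightIndex

namespace WeightIndex

/-! For the couple `(L¹, L^∞)` the K-functional of `f` at `t` is `I(t) = ∫₀ᵗ f^*`
(`kFunctional_one_top_eq`), so the theorem compares power bounds for `I` with power bounds for
`f^*`, uniformly over cubes. If `I(s) ≤ C (s/t)^δ I(t)`, choose `A` with `2 C A^(-δ) ≤ 1`. Then at
most half of `I(At)` comes from `(0, t)`, so `I(At) ≤ 2At f^*(t)`, and `s f^*(s) ≤ I(s) ≤ C (s/t)^δ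
I(At)` gives the exponent `1 - δ` for `f^*` (`rearrangement_div_le_of_lintegral_le`). Conversely,
integrating `f^*(qu) ≤ c q^(-a) f^*(u)` with `q = s/t` over `u ∈ (0, t)` and rescaling gives `I` the
exponent `1 - a` (`lintegral_rearrangement_le_of_div_le`). -/

lemma setOf_ofReal_lt_enorm {α : Type*} {l : ℝ} (hl : 0 ≤ l) (f : α → ℝ) :
    {x | ENNReal.ofReal l < ‖f x‖ₑ} = {x | l < ‖f x‖} := by
  ext x
  simp only [mem_ofPred_eq, ← ofReal_norm]
  exact ENNReal.ofReal_lt_ofReal_iff_of_nonneg hl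

/-! ### Rearrangements and the K-functional of `(L¹, L^∞)` -/

section Rearrangement

variable {α : Type*} [MeasurableSpace α] {μ : Measure α} {f : α → ℝ}

lemma lt_measure_of_lt_rearrangement {l u : ℝ} (hl : 0 ≤ l)
    (h : ENNReal.ofReal l < rearrangement μ f u) : ENNReal.ofReal u < μ {x | l < ‖f x‖} := by
  by_contra! H
  refine absurd h (not_lt.2 (sInf_le ?_))
  rwa [mem_ofPred_eq, setOf_ofReal_lt_enorm hl]

lemma measure_le_of_rearrangement_lt {l u : ℝ} (hl : 0 ≤ l)
    (h : rearrangement μ f u < ENNReal.ofReal l) : μ {x | l < ‖f x‖} ≤ ENNReal.ofReal u := by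
  obtain ⟨a, ha, hal⟩ := sInf_lt_iff.1 h
  refine le_trans (measure_mono ?_) ha
  rw [← setOf_ofReal_lt_enorm hl]
  exact fun x hx => hal.trans hx

lemma rearrangement_antitone : Antitone (rearrangement μ f) := fun _ _ hst =>
  sInf_le_sInf fun _ ha => le_trans (show _ ≤ _ from ha) (ENNReal.ofReal_le_ofReal hst)

/-- The set is an interval from `0` to `f^*(u)`, up to its right endpoint: `f^*` is a generalized
inverse of the distribution function. -/
lemma volume_setOf_lt_measure (u : ℝ) :
    volume ({l : ℝ | ENNReal.ofReal u < μ {x | l < ‖f x‖}} ∩ Ioi 0) = rearrangement μ f u := by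
  apply le_antisymm
  · by_cases hR : rearrangement μ f u = ∞
    · simp [hR]
    calc _ ≤ volume (Ioc 0 (rearrangement μ f u).toReal) := by
          refine measure_mono fun l hl => ⟨hl.2, ?_⟩
          by_contra! H
          refine absurd hl.1 (not_lt.2 (measure_le_of_rearrangement_lt (le_of_lt hl.2) ?_))
          exact (ENNReal.lt_ofReal_iff_toReal_lt hR).2 H
      _ = _ := by simp [hR]
  · by_cases hR : rearrangement μ f u = ∞
    · calc _ ≤ volume (Ioi (0 : ℝ)) := by simp
        _ ≤ _ := measure_mono fun l (hl : 0 < l) => show _ ∧ _ from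
          ⟨lt_measure_of_lt_rearrangement hl.le (by simp [hR]), hl⟩
    calc _ = volume (Ioo 0 (rearrangement μ f u).toReal) := by simp [hR]
      _ ≤ _ := measure_mono fun l hl => show _ ∧ _ from
          ⟨lt_measure_of_lt_rearrangement (le_of_lt hl.1)
            ((ENNReal.ofReal_lt_iff_lt_toReal (le_of_lt hl.1) hR).2 hl.2), hl.1⟩

lemma antitone_measure_lt_norm (μ : Measure α) (f : α → ℝ) :
    Antitone fun l : ℝ => μ {x | l < ‖f x‖} :=
  fun _ _ h => measure_mono fun _ hx => lt_of_le_of_lt h hx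

lemma volume_Ioo_inter_ofReal_lt (t : ℝ) (d : ℝ≥0∞) :
    volume ({u : ℝ | ENNReal.ofReal u < d} ∩ Ioo 0 t) = min (ENNReal.ofReal t) d := by
  by_cases hd : d = ∞
  · simp [hd]
  have : {u : ℝ | ENNReal.ofReal u < d} ∩ Ioo 0 t = Ioo 0 (min t d.toReal) := by
    ext u
    simp only [mem_inter_iff, mem_ofPred_eq, mem_Ioo, lt_min_iff]
    constructor
    · rintro ⟨h, h0, ht⟩
      exact ⟨h0, ht, (ENNReal.ofReal_lt_iff_lt_toReal h0.le hd).1 h⟩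
    · rintro ⟨h0, ht, h⟩
      exact ⟨(ENNReal.ofReal_lt_iff_lt_toReal h0.le hd).2 h, h0, ht⟩
  rw [this, Real.volume_Ioo, sub_zero, ENNReal.ofReal_min, ENNReal.ofReal_toReal hd]

/-- The integral of the decreasing rearrangement over `(0, t)` in terms of the distribution
function. -/
lemma lintegral_rearrangement_eq (t : ℝ) :
    ∫⁻ u in Ioo 0 t, rearrangement μ f u =
      ∫⁻ l in Ioi (0 : ℝ), min (ENNReal.ofReal t) (μ {x | l < ‖f x‖}) := by
  set D : ℝ → ℝ≥0∞ := fun l => μ {x | l < ‖f x‖} with hD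
  have hDm : Measurable D := (antitone_measure_lt_norm μ f).measurable
  -- Tonelli on the region under the graph of the distribution function; the two slicings give the
  -- two sides.
  have hS : MeasurableSet {p : ℝ × ℝ | ENNReal.ofReal p.2 < D p.1} :=
    measurableSet_lt (by fun_prop) (hDm.comp measurable_fst)
  have hswap := lintegral_lintegral_swap (μ := volume.restrict (Ioi (0 : ℝ)))
    (ν := volume.restrict (Ioo 0 t))
    (f := fun l u => {p : ℝ × ℝ | ENNReal.ofReal p.2 < D p.1}.indicator (fun _ => (1 : ℝ≥0∞)) (l, u))
    (measurable_const.indicator hS).aemeasurable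
  have h1 : ∀ l : ℝ, ∫⁻ u in Ioo 0 t,
      {p : ℝ × ℝ | ENNReal.ofReal p.2 < D p.1}.indicator (fun _ => (1 : ℝ≥0∞)) (l, u)
        = min (ENNReal.ofReal t) (D l) := by
    intro l
    have hm : MeasurableSet {u : ℝ | ENNReal.ofReal u < D l} :=
      measurableSet_lt (by fun_prop) measurable_const
    rw [← volume_Ioo_inter_ofReal_lt, ← Measure.restrict_apply hm, ← lintegral_indicator_one hm]
    rfl
  have h2 : ∀ u : ℝ, ∫⁻ l in Ioi (0 : ℝ),
      {p : ℝ × ℝ | ENNReal.ofReal p.2 < D p.1}.indicator (fun _ => (1 : ℝ≥0∞)) (l, u)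
        = rearrangement μ f u := by
    intro u
    have hm : MeasurableSet {l : ℝ | ENNReal.ofReal u < D l} :=
      measurableSet_lt measurable_const hDm
    rw [← volume_setOf_lt_measure, ← Measure.restrict_apply hm, ← lintegral_indicator_one hm]
    rfl
  simp only [h1, h2] at hswap
  exact hswap.symm

lemma lintegral_enorm_eq_lintegral_measure_lt (hf : AEStronglyMeasurable f μ) :
    ∫⁻ x, ‖f x‖ₑ ∂μ = ∫⁻ l in Ioi (0 : ℝ), μ {x | l < ‖f x‖} := by
  rw [← lintegral_eq_lintegral_meas_lt μ (Filter.Eventually.of_forall fun x => norm_nonneg _)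
    hf.norm.aemeasurable]
  simp only [ofReal_norm]

lemma lintegral_Ioi_shift (a : ℝ) (F : ℝ → ℝ≥0∞) :
    ∫⁻ l in Ioi (0 : ℝ), F (l + a) = ∫⁻ l in Ioi a, F l := by
  rw [← lintegral_indicator measurableSet_Ioi, ← lintegral_indicator measurableSet_Ioi,
    ← lintegral_add_right_eq_self (fun l => (Ioi a).indicator F l) a]
  refine lintegral_congr fun l => ?_
  simp [indicator]

lemma lintegral_Ioi_eq_add {a : ℝ} (ha : 0 ≤ a) (F : ℝ → ℝ≥0∞) :
    ∫⁻ l in Ioi (0 : ℝ), F l = (∫⁻ l in Ioc 0 a, F l) + ∫⁻ l in Ioi a, F l := by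
  rw [← lintegral_union measurableSet_Ioi, Ioc_union_Ioi_eq_Ioi ha]
  exact disjoint_left.2 fun x hx hx' => not_lt.2 hx.2 hx'

/-- With `M = ‖h‖_∞`, `|f| > l + M` forces `|g| > l`. Levels above `M` are thus paid for by `‖g‖₁`,
and levels below `M` cost at most `t` each. -/
lemma lintegral_rearrangement_le_of_add {g h : α → ℝ} {t : ℝ} (hg : MemLp g 1 μ)
    (hh : MemLp h ∞ μ) (hfgh : f =ᵐ[μ] g + h) :
    ∫⁻ u in Ioo 0 t, rearrangement μ f u ≤
      eLpNorm g 1 μ + ENNReal.ofReal t * eLpNorm h ∞ μ := by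
  set M := (eLpNorm h ∞ μ).toReal with hM
  have hM0 : 0 ≤ M := ENNReal.toReal_nonneg
  have hhM : ∀ᵐ x ∂μ, ‖h x‖ ≤ M := by
    filter_upwards [ae_le_eLpNormEssSup (f := h) (μ := μ)] with x hx
    rw [← eLpNorm_exponent_top] at hx
    rw [hM, ← toReal_enorm]
    exact ENNReal.toReal_mono hh.eLpNorm_ne_top hx
  rw [lintegral_rearrangement_eq, lintegral_Ioi_eq_add hM0, add_comm]
  gcongr
  · rw [eLpNorm_one_eq_lintegral_enorm, lintegral_enorm_eq_lintegral_measure_lt hg.1,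
      ← lintegral_Ioi_shift]
    refine lintegral_mono fun l => (min_le_right _ _).trans (measure_mono_ae ?_)
    filter_upwards [hhM, hfgh] with x hx hfx
    intro (hlx : l + M < ‖f x‖)
    rw [hfx, Pi.add_apply] at hlx
    show l < ‖g x‖
    linarith [norm_add_le (g x) (h x)]
  · calc _ ≤ ∫⁻ l in Ioc 0 M, ENNReal.ofReal t := lintegral_mono fun l => min_le_left _ _
      _ = _ := by
        rw [setLIntegral_const, Real.volume_Ioc, sub_zero, hM,
          ENNReal.ofReal_toReal hh.eLpNorm_ne_top]

lemma rearrangement_ne_top (hf : MemLp f 1 μ) {t : ℝ} (ht : 0 < t) :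
    rearrangement μ f t ≠ ∞ := by
  intro h
  have hle : (∞ : ℝ≥0∞) ≤ ∫⁻ x, ‖f x‖ₑ ∂μ := by
    rw [lintegral_enorm_eq_lintegral_measure_lt hf.1]
    calc (∞ : ℝ≥0∞) = ∫⁻ l in Ioi (0 : ℝ), ENNReal.ofReal t := by simp [ht]
      _ ≤ _ := setLIntegral_mono' measurableSet_Ioi fun l hl =>
        (lt_measure_of_lt_rearrangement (le_of_lt hl) (by simp [h])).le
  rw [← eLpNorm_one_eq_lintegral_enorm] at hle
  exact hf.eLpNorm_ne_top (top_le_iff.1 hle)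

/-- The K-functional of the couple `(L¹, L^∞)` is the integral of the decreasing rearrangement. -/
lemma kFunctional_one_top_eq (hf : MemLp f 1 μ) {t : ℝ} (ht : 0 < t) :
    kFunctional μ 1 ∞ f t = ∫⁻ u in Ioo 0 t, rearrangement μ f u := by
  apply le_antisymm
  -- Truncating `f` at height `a = f^*(t)` is optimal: the minimum in the layer-cake formula is `t`
  -- below `a` and the distribution function above it.
  · set a := (rearrangement μ f t).toReal with ha
    have hR := rearrangement_ne_top hf ht
    have ha0 : 0 ≤ a := ENNReal.toReal_nonneg
    have hhm : AEStronglyMeasurable (fun x => max (-a) (min (f x) a)) μ := by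
      have := hf.1
      exact (aestronglyMeasurable_const.sup (this.inf aestronglyMeasurable_const))
    have hhb : ∀ x, ‖max (-a) (min (f x) a)‖ ≤ a := fun x => by
      rw [Real.norm_eq_abs, abs_le]
      exact ⟨le_max_left _ _, max_le (by linarith) (min_le_right _ _)⟩
    have hhT : MemLp (fun x => max (-a) (min (f x) a)) ∞ μ :=
      memLp_top_of_bound hhm a (Filter.Eventually.of_forall hhb)
    have hgn : ∀ x, ‖f x - max (-a) (min (f x) a)‖ = max (‖f x‖ - a) 0 := fun x => by
      simp only [Real.norm_eq_abs]
      grind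
    have hg1 : MemLp (fun x => f x - max (-a) (min (f x) a)) 1 μ := by
      refine hf.mono (hf.1.sub hhm) (Filter.Eventually.of_forall fun x => ?_)
      rw [hgn]
      exact max_le (by linarith) (norm_nonneg _)
    refine (iInf₂_le (fun x => f x - max (-a) (min (f x) a))
      (fun x => max (-a) (min (f x) a))).trans ((iInf₂_le hg1 hhT).trans ((iInf_le _ ?_).trans ?_))
    · exact Filter.Eventually.of_forall fun x => by simp
    rw [lintegral_rearrangement_eq, lintegral_Ioi_eq_add ha0, add_comm]
    gcongr
    · calc ENNReal.ofReal t * eLpNorm (fun x => max (-a) (min (f x) a)) ∞ μ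
          ≤ ENNReal.ofReal t * ENNReal.ofReal a := by
            gcongr
            rw [eLpNorm_exponent_top]
            exact eLpNormEssSup_le_of_ae_bound (Filter.Eventually.of_forall hhb)
        _ = ∫⁻ l in Ioo 0 a, ENNReal.ofReal t := by simp
        _ ≤ ∫⁻ l in Ioo 0 a, min (ENNReal.ofReal t) (μ {x | l < ‖f x‖}) :=
            setLIntegral_mono' measurableSet_Ioo fun l hl =>
              le_min le_rfl (lt_measure_of_lt_rearrangement hl.1.le
                ((ENNReal.ofReal_lt_iff_lt_toReal hl.1.le hR).2 hl.2)).le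
        _ ≤ _ := lintegral_mono_set Ioo_subset_Ioc_self
    · rw [eLpNorm_one_eq_lintegral_enorm, lintegral_enorm_eq_lintegral_measure_lt hg1.1,
        ← lintegral_Ioi_shift a]
      refine setLIntegral_mono' measurableSet_Ioi fun l (hl : 0 < l) => ?_
      have hsub : {x | l < ‖f x - max (-a) (min (f x) a)‖} = {x | l + a < ‖f x‖} := by
        ext x
        simp only [mem_ofPred_eq, hgn, lt_max_iff, lt_sub_iff_add_lt]
        exact or_iff_left (not_lt.2 hl.le)
      rw [hsub]
      refine le_min (measure_le_of_rearrangement_lt (by linarith) ?_) le_rfl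
      exact (ENNReal.lt_ofReal_iff_toReal_lt hR).2 (by linarith)
  · exact le_iInf₂ fun g h => le_iInf₂ fun hg hh => le_iInf fun hfgh =>
      lintegral_rearrangement_le_of_add hg hh hfgh

lemma lintegral_rearrangement_ne_top (hf : MemLp f 1 μ) (t : ℝ) :
    ∫⁻ u in Ioo 0 t, rearrangement μ f u ≠ ∞ := by
  refine ne_top_of_le_ne_top hf.eLpNorm_ne_top ?_
  simpa using lintegral_rearrangement_le_of_add (t := t) hf (MemLp.zero : MemLp (0 : α → ℝ) ∞ μ)
    (by simp)

lemma mul_rearrangement_le_lintegral (t : ℝ) :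
    ENNReal.ofReal t * rearrangement μ f t ≤ ∫⁻ u in Ioo 0 t, rearrangement μ f u :=
  calc _ = ∫⁻ u in Ioo 0 t, rearrangement μ f t := by simp [mul_comm]
    _ ≤ _ := setLIntegral_mono' measurableSet_Ioo fun _ hu => rearrangement_antitone hu.2.le

lemma lintegral_rearrangement_le_add {s t : ℝ} (hs : 0 ≤ s) :
    ∫⁻ u in Ioo 0 t, rearrangement μ f u ≤
      (∫⁻ u in Ioo 0 s, rearrangement μ f u) + ENNReal.ofReal t * rearrangement μ f s := by
  calc _ ≤ ∫⁻ u in Ioo 0 s ∪ Ico s t, rearrangement μ f u := by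
        refine lintegral_mono_set fun u hu => ?_
        rcases lt_or_ge u s with h | h
        · exact Or.inl ⟨hu.1, h⟩
        · exact Or.inr ⟨h, hu.2⟩
    _ ≤ (∫⁻ u in Ioo 0 s, rearrangement μ f u) + ∫⁻ u in Ico s t, rearrangement μ f u :=
        lintegral_union_le _ _ _
    _ ≤ _ := by
        gcongr
        calc _ ≤ ∫⁻ u in Ico s t, rearrangement μ f s :=
              setLIntegral_mono' measurableSet_Ico fun u hu => rearrangement_antitone hu.1
          _ = rearrangement μ f s * ENNReal.ofReal (t - s) := by simp
          _ ≤ _ := by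
            rw [mul_comm]
            gcongr
            linarith

lemma lintegral_Ioo_scale {s t : ℝ} (hs : 0 < s) (ht : 0 < t) (F : ℝ → ℝ≥0∞) :
    ∫⁻ u in Ioo 0 s, F u = ENNReal.ofReal (s / t) * ∫⁻ u in Ioo 0 t, F (s / t * u) := by
  have hst : 0 < s / t := div_pos hs ht
  have him : (fun u => s / t * u) '' Ioo 0 t = Ioo 0 s := by
    rw [image_mul_left_Ioo hst, mul_zero, div_mul_cancel₀ _ ht.ne']
  rw [← him, lintegral_image_eq_lintegral_abs_deriv_mul measurableSet_Ioo
    (f' := fun _ => s / t) (fun x _ => by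
      simpa using ((hasDerivAt_id x).const_mul (s / t)).hasDerivWithinAt)
    (fun x _ y _ h => mul_left_cancel₀ hst.ne' h),
    lintegral_const_mul' _ _ ENNReal.ofReal_ne_top, abs_of_pos hst]

end Rearrangement

/-! ### Weights restricted to cubes -/

section Cube

variable {n : ℕ} {w : (Fin n → ℝ) → ℝ} {Q : Set (Fin n → ℝ)}

lemma IsCube.isCompact (hQ : IsCube Q) : IsCompact Q := by
  obtain ⟨a, l, -, rfl⟩ := hQ
  have : {x : Fin n → ℝ | ∀ i, a i ≤ x i ∧ x i ≤ a i + l} = Icc a (fun i => a i + l) := by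
    ext x
    simp [Pi.le_def, forall_and]
  rw [this]
  exact isCompact_Icc

lemma IsWeight.memLp_indicator (hw : IsWeight w) (hQ : IsCube Q) :
    MemLp (Q.indicator w) 1 (volume.restrict Q) := by
  have h : IntegrableOn w Q := hw.locallyIntegrable.integrableOn_isCompact hQ.isCompact
  rw [memLp_one_iff_integrable]
  exact (h.integrable_indicator hQ.isCompact.measurableSet).restrict

lemma rearrangement_indicator_restrict (hQ : MeasurableSet Q) (w : (Fin n → ℝ) → ℝ) (t : ℝ) :
    rearrangement (volume.restrict Q) (Q.indicator w) t =
      rearrangement volume (Q.indicator w) t := by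
  unfold rearrangement
  congr 1
  ext a
  rw [mem_ofPred_eq, mem_ofPred_eq, Measure.restrict_apply' hQ, inter_eq_left.2]
  intro x hx
  by_contra hxQ
  simp [hxQ] at hx

lemma kFamily_eq (hw : IsWeight w) (hQ : IsCube Q) {t : ℝ} (ht : 0 < t) :
    kFamily w Q t = ∫⁻ u in Ioo 0 t, rearrangement volume (Q.indicator w) u := by
  rw [kFamily, kFunctional_one_top_eq (hw.memLp_indicator hQ) ht]
  simp only [rearrangement_indicator_restrict hQ.isCompact.measurableSet]

end Cube

/-! ### Transfer of power bounds between `f^*` and its integral -/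

lemma mul_rpow_neg_le_iff {s t δ : ℝ} (hs : 0 < s) (ht : 0 < t) (x y c : ℝ≥0∞) :
    x * ENNReal.ofReal (s ^ (-δ)) ≤ c * (y * ENNReal.ofReal (t ^ (-δ))) ↔
      x ≤ c * ENNReal.ofReal ((s / t) ^ δ) * y := by
  have hs' : 0 < s ^ (-δ) := Real.rpow_pos_of_pos hs _
  have key : t ^ (-δ) = (s / t) ^ δ * s ^ (-δ) := by
    rw [Real.div_rpow hs.le ht.le, Real.rpow_neg hs.le, Real.rpow_neg ht.le]
    have := (Real.rpow_pos_of_pos hs δ).ne'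
    field_simp
  rw [key, ENNReal.ofReal_mul (by positivity)]
  rw [show c * (y * (ENNReal.ofReal ((s / t) ^ δ) * ENNReal.ofReal (s ^ (-δ)))) =
    (c * ENNReal.ofReal ((s / t) ^ δ) * y) * ENNReal.ofReal (s ^ (-δ)) by ring]
  exact ENNReal.mul_le_mul_iff_left (by simpa using hs') ENNReal.ofReal_ne_top

/-- Absorption: finiteness of `x` allows half of it to be cancelled. -/
lemma le_two_mul_of_le_half_add {x y z : ℝ≥0∞} (hx : x ≠ ∞) (hy : 2 * y ≤ x) (h : x ≤ y + z) :
    x ≤ 2 * z := by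
  have h1 : x + x ≤ x + 2 * z :=
    calc x + x = 2 * x := (two_mul x).symm
      _ ≤ 2 * (y + z) := by gcongr
      _ = 2 * y + 2 * z := mul_add _ _ _
      _ ≤ _ := by gcongr
  exact (ENNReal.add_le_add_iff_left hx).1 h1

/-- A power lower type bound for the integral mean of a rearrangement, for one function, transfers
to a power bound of the rearrangement itself. -/
lemma rearrangement_div_le_of_lintegral_le {α : Type*} [MeasurableSpace α] {μ : Measure α}
    {f : α → ℝ} (hf : MemLp f 1 μ) {C A : ℝ≥0} {δ l : ℝ} (hA : 1 ≤ A)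
    (hCA : 2 * C * A ^ (-δ) ≤ 1)
    (h : ∀ s t : ℝ, 0 < s → s ≤ t → t < l → ∫⁻ u in Ioo 0 s, rearrangement μ f u ≤
      C * ENNReal.ofReal ((s / t) ^ δ) * ∫⁻ u in Ioo 0 t, rearrangement μ f u)
    {s t : ℝ} (hs : 0 < s) (hst : s ≤ t) (ht : A * t < l) :
    rearrangement μ f s / rearrangement μ f t ≤
      (2 * A * C : ℝ≥0) * ENNReal.ofReal ((s / t) ^ (-(1 - δ))) := by
  have ht0 : 0 < t := hs.trans_le hst
  have hA' : (1 : ℝ) ≤ A := by exact_mod_cast hA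
  have hA0 : (0 : ℝ) < A := by linarith
  have htA : t ≤ A * t := le_mul_of_one_le_left ht0.le hA'
  have hI : ∫⁻ u in Ioo 0 (A * t), rearrangement μ f u ≤
      2 * (ENNReal.ofReal (A * t) * rearrangement μ f t) := by
    refine le_two_mul_of_le_half_add (lintegral_rearrangement_ne_top hf _) ?_
      (lintegral_rearrangement_le_add ht0.le)
    calc _ ≤ 2 * (C * ENNReal.ofReal ((t / (A * t)) ^ δ) *
          ∫⁻ u in Ioo 0 (A * t), rearrangement μ f u) := by
          gcongr
          exact h t (A * t) ht0 htA ht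
      _ = (2 * C * A ^ (-δ) : ℝ≥0) * ∫⁻ u in Ioo 0 (A * t), rearrangement μ f u := by
          have : (t / (A * t)) ^ δ = (A ^ (-δ) : ℝ≥0) := by
            rw [NNReal.coe_rpow, Real.rpow_neg hA0.le, ← Real.inv_rpow hA0.le]
            congr 1
            field_simp
          rw [this, ENNReal.ofReal_coe_nnreal]
          push_cast
          ring
      _ ≤ 1 * ∫⁻ u in Ioo 0 (A * t), rearrangement μ f u := by
          gcongr
          exact_mod_cast hCA
      _ = _ := one_mul _
  have hmain : ENNReal.ofReal s * rearrangement μ f s ≤ ENNReal.ofReal s *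
      ((2 * A * C : ℝ≥0) * ENNReal.ofReal ((s / t) ^ (-(1 - δ))) * rearrangement μ f t) := by
    calc _ ≤ ∫⁻ u in Ioo 0 s, rearrangement μ f u := mul_rearrangement_le_lintegral s
      _ ≤ C * ENNReal.ofReal ((s / t) ^ δ) * ∫⁻ u in Ioo 0 t, rearrangement μ f u :=
          h s t hs hst (htA.trans_lt ht)
      _ ≤ C * ENNReal.ofReal ((s / t) ^ δ) *
          (2 * (ENNReal.ofReal (A * t) * rearrangement μ f t)) := by
          gcongr
          exact (lintegral_mono_set (Ioo_subset_Ioo_right htA)).trans hI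
      _ = _ := by
          have : (s / t) ^ δ * t = s * (s / t) ^ (-(1 - δ)) := by
            rw [neg_sub, Real.rpow_sub_one (by positivity)]
            field_simp
          have h2 : ENNReal.ofReal ((s / t) ^ δ) * ENNReal.ofReal t =
              ENNReal.ofReal s * ENNReal.ofReal ((s / t) ^ (-(1 - δ))) := by
            rw [← ENNReal.ofReal_mul (by positivity), ← ENNReal.ofReal_mul hs.le, this]
          rw [ENNReal.ofReal_mul hA0.le, ENNReal.ofReal_coe_nnreal]
          push_cast
          calc _ = ENNReal.ofReal ((s / t) ^ δ) * ENNReal.ofReal t *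
                (2 * A * C * rearrangement μ f t) := by ring
            _ = _ := by rw [h2]; ring
  exact ENNReal.div_le_of_le_mul
    ((ENNReal.mul_le_mul_iff_right (by simpa using hs) ENNReal.ofReal_ne_top).1 hmain)

/-- Integrating a power bound for the rearrangement. -/
lemma lintegral_rearrangement_le_of_div_le {α : Type*} [MeasurableSpace α] {μ : Measure α}
    {f : α → ℝ} {c : ℝ≥0} (hc : 0 < c) {a l : ℝ}
    (h : ∀ s t : ℝ, 0 < s → s ≤ t → t < l → rearrangement μ f s / rearrangement μ f t ≤
      c * ENNReal.ofReal ((s / t) ^ (-a)))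
    {s t : ℝ} (hs : 0 < s) (hst : s ≤ t) (ht : t < l) :
    ∫⁻ u in Ioo 0 s, rearrangement μ f u ≤
      c * ENNReal.ofReal ((s / t) ^ (1 - a)) * ∫⁻ u in Ioo 0 t, rearrangement μ f u := by
  have ht0 : 0 < t := hs.trans_le hst
  have hq : 0 < s / t := div_pos hs ht0
  have hq1 : s / t ≤ 1 := (div_le_one ht0).2 hst
  set B : ℝ≥0∞ := c * ENNReal.ofReal ((s / t) ^ (-a)) with hB
  have hB0 : B ≠ 0 := mul_ne_zero (by simpa using hc.ne')
    (by simpa using Real.rpow_pos_of_pos hq _)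
  have hBT : B ≠ ∞ := ENNReal.mul_ne_top ENNReal.coe_ne_top ENNReal.ofReal_ne_top
  rw [lintegral_Ioo_scale hs ht0]
  calc _ ≤ ENNReal.ofReal (s / t) * ∫⁻ u in Ioo 0 t, B * rearrangement μ f u := by
        refine mul_le_mul_right (setLIntegral_mono' measurableSet_Ioo fun u hu => ?_) _
        have := h (s / t * u) u (mul_pos hq hu.1) (mul_le_of_le_one_left hu.1.le hq1)
          (hu.2.trans ht)
        rw [mul_div_cancel_right₀ _ hu.1.ne'] at this
        exact (ENNReal.div_le_iff_le_mul (Or.inr hBT) (Or.inr hB0)).1 this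
    _ = _ := by
        rw [lintegral_const_mul' _ _ hBT, hB, sub_eq_add_neg, Real.rpow_add hq,
          Real.rpow_one, ENNReal.ofReal_mul hq.le]
        ring

end WeightIndex

open WeightIndex in
theorem mainTheorem8 (n : ℕ) (hn : 1 ≤ n) (w : (Fin n → ℝ) → ℝ)
    (hw : WeightIndex.IsWeight w) :
    0 < WeightIndex.familyIndex (WeightIndex.kFamily w) ↔
      WeightIndex.rearrangementIndex w < 1 := by
  constructor
  · intro h
    simp only [familyIndex, lt_iSup_iff, ENNReal.coe_pos] at h
    obtain ⟨δ₀, ⟨γ, hγ, C, hC⟩, hδ₀⟩ := h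
    -- The exponent `1 - δ` must be positive; lowering `δ₀` is harmless since `s / t ≤ 1`.
    obtain ⟨δ, hδ, hδδ₀, hδ1⟩ : ∃ δ : ℝ≥0, 0 < δ ∧ δ ≤ δ₀ ∧ δ < 1 :=
      ⟨min δ₀ (1 / 2), lt_min hδ₀ (by norm_num), min_le_left _ _,
        (min_le_right _ _).trans_lt (by norm_num)⟩
    obtain ⟨A, hA1, hA⟩ : ∃ A : ℝ≥0, 1 ≤ A ∧ 2 * C * A ^ (-(δ : ℝ)) ≤ 1 := by
      have h1 : (1 : ℝ≥0) ≤ max 1 (2 * C) := le_max_left _ _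
      refine ⟨(max 1 (2 * C)) ^ (1 / (δ : ℝ)), NNReal.one_le_rpow h1 (by positivity), ?_⟩
      have hδ' : (δ : ℝ) ≠ 0 := by exact_mod_cast hδ.ne'
      rw [← NNReal.rpow_mul, show 1 / (δ : ℝ) * -(δ : ℝ) = -1 by field_simp, NNReal.rpow_neg_one]
      exact mul_inv_le_one_of_le₀ (le_max_right _ _) zero_le
    have hAr : (1 : ℝ) ≤ A := by exact_mod_cast hA1
    have hgrowth : RearrangementGrowth w (1 - δ) := by
      -- Dividing by `A` keeps `A * t` in the range of the hypothesis. The `max` makes the constant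
      -- positive before a cube is available to supply `1 ≤ C`.
      refine ⟨tsub_pos_of_lt hδ1, γ / A, ⟨by have := hγ.1; positivity,
        (div_le_self hγ.1.le hAr).trans_lt hγ.2⟩, 2 * A * max 1 C, by positivity, ?_⟩
      intro Q hQ s t hs hst ht
      have hCQ := (hC Q hQ)
      rw [max_eq_right hCQ.1, NNReal.coe_sub hδ1.le, NNReal.coe_one]
      simp only [← rearrangement_indicator_restrict hQ.isCompact.measurableSet]
      refine rearrangement_div_le_of_lintegral_le (hw.memLp_indicator hQ) (l := γ * volume.real Q)
        hA1 hA ?_ hs hst ?_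
      · intro s t hs hst ht
        have ht0 := hs.trans_le hst
        have := (mul_rpow_neg_le_iff hs ht0 _ _ _).1
          (hCQ.2 s ⟨hs, hst.trans_lt ht⟩ t ⟨ht0, ht⟩ hst)
        simp only [kFamily, kFunctional_one_top_eq (hw.memLp_indicator hQ) hs,
          kFunctional_one_top_eq (hw.memLp_indicator hQ) ht0] at this
        refine this.trans (mul_le_mul_left (mul_le_mul_right (ENNReal.ofReal_le_ofReal ?_) _) _)
        exact Real.rpow_le_rpow_of_exponent_ge (div_pos hs ht0) ((div_le_one ht0).2 hst)
          (NNReal.coe_le_coe.2 hδδ₀)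
      · rw [div_mul_eq_mul_div, lt_div_iff₀ (by linarith)] at ht
        linarith
    calc rearrangementIndex w ≤ ((1 - δ : ℝ≥0) : ℝ≥0∞) := iInf₂_le _ hgrowth
      _ < 1 := by exact_mod_cast tsub_lt_self one_pos hδ
  · intro h
    simp only [rearrangementIndex, iInf_lt_iff] at h
    obtain ⟨a, ⟨ha0, r, hr, c, hc, H⟩, ha⟩ := h
    have ha1 : a < 1 := by exact_mod_cast ha
    have hind : ((1 - a : ℝ≥0) : ℝ≥0∞) ≤ familyIndex (kFamily w) := by
      refine le_iSup₂_of_le (1 - a) ⟨r, hr, max 1 c, fun Q hQ => ⟨le_max_left _ _, ?_⟩⟩ le_rfl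
      intro s hs t ht hst
      refine (mul_rpow_neg_le_iff hs.1 ht.1 _ _ _).2 ?_
      rw [kFamily_eq hw hQ hs.1, kFamily_eq hw hQ ht.1, NNReal.coe_sub ha1.le, NNReal.coe_one]
      refine (lintegral_rearrangement_le_of_div_le hc (H Q hQ) hs.1 hst ht.2).trans ?_
      gcongr
      exact le_max_right _ _
    refine lt_of_lt_of_le ?_ hind
    exact_mod_cast tsub_pos_of_lt ha1
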